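/- Let $\omega((v,\alpha),(w,\beta))=\beta(v)-\alpha(w)$ be the canonical symplectic form of $\mathbb R^n\oplus{\mathbb R^n}^*$ and let $L_0=\{0\}\oplus{\mathbb R^n}^*$. *Maslov index.* For Lagrangian subspaces $L_1,L$ with $L_1\cap L_0=L_1\cap L=\{0\}$ let $\varphi_{L_0,L_1}(L)$ be the symmetric bilinear form $\omega(S\cdot,\cdot)$ on $L_0$, where $S:L_0\to L_1$ is the unique linear map with graph $\{x+Sx:x\in L_0\}=L$, and set $e_{L_1}(L)=\mathrm n_+(\varphi_{L_0,L_1}(L))+\dim(L\cap L_0)$, where $\mathrm n_+$ is the largest dimension of a subspace on which the form is positive definite. The $L_0$-Maslov index of a continuous curve $\ell$ of Lagrangians on $[a,b]$ is $$\mu_{L_0}(\ell)=\sum_{i<k}\bigl(e_{L_1^i}(\ell(t_{i+1}))-e_{L_1^i}(\ell(t_i))\bigr)$$ for any subdivision $a=t_0\le\dots\le t_k=b$ and any Lagrangians $L_1^i$ such that $L_1^i$ is transversal to $L_0$ and to $\ell(s)$ for all $s\in[t_i,t_{i+1}]$. *Symplectic systems.* Let $T>0$. For a constant matrix $X\in\mathrm{sp}(2n,\mathbb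 R)$ consider the system $(v,\alpha)'=X(v,\alpha)$ on $[0,T]$, with fundamental solution $\Phi(t)=\exp(tX)$, and let $\ell_X(t)=\Phi(t)(L_0)$. An instant $t\in(0,T]$ is conjugate for this system if $\ell_X(t)\cap L_0\neq\{0\}$; its multiplicity is $\dim(\ell_X(t)\cap L_0)$; the Maslov index of the system is $\mu_{L_0}(\ell_X)$ on $[0,T]$. *Second order systems.* For a nondegenerate symmetric bilinear form $g$ on $\mathbb R^n$ and a $g$-symmetric endomorphism $A$, an instant $t\in(0,T]$ is conjugate for the system $v''=Av$ on $[0,T]$ if there is a not identically zero solution $v$ with $v(0)=v(t)=0$; its multiplicity is the dimension of the space of solutions $v$ with $v(0)=v(t)=0$. The Maslov index $\mu(g,A,T)$ of $v''=Av$ is the Maslov index on $[0,T]$ of the symplectic system with matrix $\begin{pmatrix}0&g^{-1}\\gA&0\end{pmatrix}$. **Statement.** Let $X=\begin{pmatrix}\mathfrak A&\mathfrak B\\ \mathfrak C&-\mathfrak A^*\end{pmatrix}$ with real $n\times n$ blocks, $\mathfrak B$ and $\mathfrak C$ symmetric (i.e. $X\in\mathrm{sp}(2n,\mathbb R)$),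 be such that $\mathfrak B$ is invertible and $\mathfrak B^{-1}\mathfrak A$ is symmetric. Put $A=\mathfrak B(\mathfrak A^*\mathfrak B^{-1}\mathfrak A+\mathfrak C)$ and $g=\mathfrak B^{-1}$. Then $g$ is symmetric and nondegenerate, $A$ is $g$-symmetric, and for every $T>0$: 1. the conjugate instants in $(0,T]$ of the symplectic system $(v,\alpha)'=X(v,\alpha)$ coincide with the conjugate instants in $(0,T]$ of the second order system $v''=Av$, and each instant of $(0,T]$ has the same multiplicity for both systems; 2. the curves of Lagrangians of both systems admit subdivisions as above, so that the Maslov indices of both systems on $[0,T]$ are given by such sums, and the Maslov index of the symplectic system equals $\mu(g,A,T)$. -/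

import Mathlib

open Matrix Set

noncomputable section

namespace ConstSympl

/-! ### The symplectic space `ℝⁿ ⊕ (ℝⁿ)*`

Elements `(v, α)` are written as functions on `Fin n ⊕ Fin n`; the left coordinates are those of `v`
in the canonical basis, the right coordinates are those of `α` in the dual basis. -/

/-- The phase space `ℝⁿ ⊕ (ℝⁿ)*`. -/
abbrev PhaseSpace (n : ℕ) : Type := Fin n ⊕ Fin n → ℝ

/-- The canonical symplectic form `ω((v, α), (w, β)) = β(v) - α(w)`. -/
def symplecticForm (n : ℕ) : LinearMap.BilinForm ℝ (PhaseSpace n) :=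
  Matrix.toBilin' (fromBlocks 0 1 (-1) 0)

theorem symplecticForm_apply (n : ℕ) (v α w β : Fin n → ℝ) :
    symplecticForm n (Sum.elim v α) (Sum.elim w β) = β ⬝ᵥ v - α ⬝ᵥ w := by
  simp [symplecticForm, Matrix.toBilin'_apply', fromBlocks_mulVec, sub_eq_add_neg,
    dotProduct_comm v β, neg_mulVec]

/-- A Lagrangian subspace: an `n`-dimensional subspace on which `ω` vanishes. -/
def IsLagrangian {n : ℕ} (L : Submodule ℝ (PhaseSpace n)) : Prop :=
  Module.finrank ℝ L = n ∧ ∀ x ∈ L, ∀ y ∈ L, symplecticForm n x y = 0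

/-- The Lagrangian subspace `L₀ = {0} ⊕ (ℝⁿ)*`. -/
def verticalLagrangian (n : ℕ) : Submodule ℝ (PhaseSpace n) where
  carrier := {z | ∀ i, z (Sum.inl i) = 0}
  add_mem' ha hb i := by simp [ha i, hb i]
  zero_mem' _ := rfl
  smul_mem' c z hz i := by simp [hz i]

/-- The `L₀`-Maslov cycle: the Lagrangians that are not transversal to `L₀`. -/
def maslovCycle {n : ℕ} (L₀ : Submodule ℝ (PhaseSpace n)) : Set (Submodule ℝ (PhaseSpace n)) :=
  {L | IsLagrangian L ∧ L ⊓ L₀ ≠ ⊥}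

/-! ### The Maslov index of a curve of Lagrangians -/

/-- `L` is the graph `{x + T x : x ∈ L₀}` of the linear map `T : L₀ → L₁`. -/
def IsGraphOf {n : ℕ} {L₀ L₁ : Submodule ℝ (PhaseSpace n)} (T : L₀ →ₗ[ℝ] L₁)
    (L : Submodule ℝ (PhaseSpace n)) : Prop :=
  ∀ z : PhaseSpace n, z ∈ L ↔ ∃ x : L₀, (x : PhaseSpace n) + (T x : PhaseSpace n) = z

/-- The linear map `T : L₀ → L₁` whose graph is `L`. It exists and is unique when `L₀`, `L₁` and `L`
are Lagrangian and `L₁` is transversal to `L₀` and to `L`; it is used only then. -/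
def graphMap {n : ℕ} (L₀ L₁ L : Submodule ℝ (PhaseSpace n)) : L₀ →ₗ[ℝ] L₁ :=
  Classical.epsilon fun T => IsGraphOf T L

/-- The bilinear form `φ_{L₀,L₁}(L) = ω(T·, ·)` on `L₀`. -/
def chartForm {n : ℕ} (L₀ L₁ L : Submodule ℝ (PhaseSpace n)) : LinearMap.BilinForm ℝ L₀ :=
  (symplecticForm n).compl₁₂ (L₁.subtype ∘ₗ graphMap L₀ L₁ L) L₀.subtype

/-- The extended coindex `n₊(φ_{L₀,L₁}(L)) + dim (L ∩ L₀)`. -/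
def extendedCoindex {n : ℕ} (L₀ L₁ L : Submodule ℝ (PhaseSpace n)) : ℤ :=
  (sigPos (LinearMap.BilinMap.toQuadraticMap (chartForm L₀ L₁ L)) : ℤ) +
    (Module.finrank ℝ (L ⊓ L₀ : Submodule ℝ (PhaseSpace n)) : ℤ)

/-- For a continuous curve `ℓ` of Lagrangians, `IsMaslovIndex L₀ ℓ a b m` says that `m` is the
`L₀`-Maslov index of `ℓ` on `[a, b]`: there are a subdivision `a = t₀ ≤ ⋯ ≤ t_k = b` and, for each
`i < k`, a Lagrangian `L₁ i` transversal to `L₀` and to `ℓ s` for all `s ∈ [tᵢ, tᵢ₊₁]`, and `m` is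
the sum of the variations of the extended coindex of `φ_{L₀, L₁ i} (ℓ ·)` on `[tᵢ, tᵢ₊₁]`.
(This is the extension by concatenation of the definition on the domain of one chart; the sum does
not depend on the subdivision or on the Lagrangians `L₁ i`.) -/
def IsMaslovIndex {n : ℕ} (L₀ : Submodule ℝ (PhaseSpace n)) (ℓ : ℝ → Submodule ℝ (PhaseSpace n))
    (a b : ℝ) (m : ℤ) : Prop :=
  ∃ (k : ℕ) (t : ℕ → ℝ) (L₁ : ℕ → Submodule ℝ (PhaseSpace n)),
    Monotone t ∧ t 0 = a ∧ t k = b ∧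
    (∀ i < k, IsLagrangian (L₁ i) ∧ L₁ i ⊓ L₀ = ⊥ ∧
      ∀ s ∈ Icc (t i) (t (i + 1)), L₁ i ⊓ ℓ s = ⊥) ∧
    m = ∑ i ∈ Finset.range k,
      (extendedCoindex L₀ (L₁ i) (ℓ (t (i + 1))) - extendedCoindex L₀ (L₁ i) (ℓ (t i)))

/-- The `L₀`-Maslov index of a continuous curve of Lagrangians on `[a, b]`. -/
def curveMaslovIndex {n : ℕ} (L₀ : Submodule ℝ (PhaseSpace n))
    (ℓ : ℝ → Submodule ℝ (PhaseSpace n)) (a b : ℝ) : ℤ :=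
  Classical.epsilon (IsMaslovIndex L₀ ℓ a b)

/-! ### Constant symplectic systems `(v, α)' = X (v, α)` on `[0, T]` -/

/-- The fundamental solution `Φ(t) = exp (t X)` of the system with constant coefficient matrix `X`,
i.e. the solution of `Φ' = X Φ`, `Φ(0) = 1`. -/
def fundamentalSolution {n : ℕ} (X : Matrix (Fin n ⊕ Fin n) (Fin n ⊕ Fin n) ℝ) (t : ℝ) :
    Matrix (Fin n ⊕ Fin n) (Fin n ⊕ Fin n) ℝ :=
  NormedSpace.exp (t • X)

theorem fundamentalSolution_zero {n : ℕ} (X : Matrix (Fin n ⊕ Fin n) (Fin n ⊕ Fin n) ℝ) :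
    fundamentalSolution X 0 = 1 := by
  simp [fundamentalSolution]

theorem hasDerivAt_fundamentalSolution {n : ℕ}
    (X : Matrix (Fin n ⊕ Fin n) (Fin n ⊕ Fin n) ℝ) (t : ℝ) :
    HasDerivAt (fundamentalSolution X) (X * fundamentalSolution X t) t := by
  let _ : NormedRing (Matrix (Fin n ⊕ Fin n) (Fin n ⊕ Fin n) ℝ) := Matrix.linftyOpNormedRing
  let _ : NormedAlgebra ℝ (Matrix (Fin n ⊕ Fin n) (Fin n ⊕ Fin n) ℝ) :=
    Matrix.linftyOpNormedAlgebra
  exact hasDerivAt_exp_smul_const' X t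

/-- The curve `ℓ(t) = Φ(t)(L₀)` with `L₀ = {0} ⊕ (ℝⁿ)*`. -/
def lagrangianCurve {n : ℕ} (X : Matrix (Fin n ⊕ Fin n) (Fin n ⊕ Fin n) ℝ) (t : ℝ) :
    Submodule ℝ (PhaseSpace n) :=
  (verticalLagrangian n).map (fundamentalSolution X t).mulVecLin

/-- The conjugate instants in `]0, T]` of the symplectic system with coefficient matrix `X`:
the instants at which `ℓ` meets the `L₀`-Maslov cycle. -/
def symplecticConjugateInstants {n : ℕ} (X : Matrix (Fin n ⊕ Fin n) (Fin n ⊕ Fin n) ℝ)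
    (T : ℝ) : Set ℝ :=
  {t | t ∈ Ioc 0 T ∧ lagrangianCurve X t ∈ maslovCycle (verticalLagrangian n)}

/-- The multiplicity `dim (ℓ(t) ∩ L₀)` of an instant `t` for the symplectic system with coefficient
matrix `X`. -/
def symplecticMultiplicity {n : ℕ} (X : Matrix (Fin n ⊕ Fin n) (Fin n ⊕ Fin n) ℝ) (t : ℝ) : ℕ :=
  Module.finrank ℝ (lagrangianCurve X t ⊓ verticalLagrangian n : Submodule ℝ (PhaseSpace n))

/-- `m` is the Maslov index on `[0, T]` of the symplectic system with coefficient matrix `X`. -/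
def IsSymplecticMaslovIndex {n : ℕ} (X : Matrix (Fin n ⊕ Fin n) (Fin n ⊕ Fin n) ℝ)
    (T : ℝ) (m : ℤ) : Prop :=
  IsMaslovIndex (verticalLagrangian n) (lagrangianCurve X) 0 T m

/-- The Maslov index on `[0, T]` of the symplectic system with coefficient matrix `X`. -/
def symplecticMaslovIndex {n : ℕ} (X : Matrix (Fin n ⊕ Fin n) (Fin n ⊕ Fin n) ℝ) (T : ℝ) : ℤ :=
  curveMaslovIndex (verticalLagrangian n) (lagrangianCurve X) 0 T

/-! ### Second order systems `v'' = A v` on `[0, T]` -/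

/-- `v` solves `v'' = A v` on the interval `I`. -/
def IsSolution {n : ℕ} (A : Matrix (Fin n) (Fin n) ℝ) (I : Set ℝ) (v : ℝ → Fin n → ℝ) : Prop :=
  ∃ w : ℝ → Fin n → ℝ, ∀ t ∈ I,
    HasDerivWithinAt v (w t) I t ∧ HasDerivWithinAt w (A *ᵥ v t) I t

/-- The vector space of the solutions `v : I → ℝⁿ` of `v'' = A v` with `v(t₀) = v(t₁) = 0`, where
`t₀, t₁ ∈ I`. -/
def conjugateSolutions {n : ℕ} (A : Matrix (Fin n) (Fin n) ℝ) (I : Set ℝ) (t₀ t₁ : ℝ) :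
    Submodule ℝ (I → Fin n → ℝ) where
  carrier := {u | ∃ v : ℝ → Fin n → ℝ, I.domRestrict v = u ∧ IsSolution A I v ∧ v t₀ = 0 ∧ v t₁ = 0}
  add_mem' := by
    rintro _ _ ⟨v, rfl, ⟨w, hw⟩, h0, h1⟩ ⟨v', rfl, ⟨w', hw'⟩, h0', h1'⟩
    refine ⟨v + v', rfl, ⟨w + w', fun t ht => ⟨(hw t ht).1.add (hw' t ht).1, ?_⟩⟩,
      by simp [h0, h0'], by simp [h1, h1']⟩
    have h := (hw t ht).2.add (hw' t ht).2
    rwa [← mulVec_add] at h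
  zero_mem' := by
    refine ⟨0, rfl, ⟨0, fun t _ => ⟨hasDerivWithinAt_const t I _, ?_⟩⟩, rfl, rfl⟩
    have h : A *ᵥ (0 : ℝ → Fin n → ℝ) t = 0 := mulVec_zero A
    rw [h]
    exact hasDerivWithinAt_const t I _
  smul_mem' := by
    rintro c _ ⟨v, rfl, ⟨w, hw⟩, h0, h1⟩
    refine ⟨c • v, rfl, ⟨c • w, fun t ht => ⟨(hw t ht).1.const_smul c, ?_⟩⟩,
      by simp [h0], by simp [h1]⟩
    have h := (hw t ht).2.const_smul c
    rwa [← mulVec_smul] at h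

/-- The instants of `]0, T]` conjugate to `0` for `v'' = A v` on `[0, T]`: there is a solution that
vanishes at `0` and at `t` and is not identically zero. -/
def conjugateInstants {n : ℕ} (A : Matrix (Fin n) (Fin n) ℝ) (T : ℝ) : Set ℝ :=
  {t | t ∈ Ioc 0 T ∧ ∃ u ∈ conjugateSolutions A (Icc 0 T) 0 t, u ≠ 0}

/-- The multiplicity of an instant `t` for `v'' = A v` on `[0, T]`: the dimension of the space of the
solutions that vanish at `0` and at `t`. -/
def multiplicity {n : ℕ} (A : Matrix (Fin n) (Fin n) ℝ) (T t : ℝ) : ℕ :=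
  Module.finrank ℝ (conjugateSolutions A (Icc 0 T) 0 t)

/-- The coefficient matrix of `v'' = A v` written as a first order system for `(v, α) = (v, g v')`.
Here `g` is the Gram matrix of a nondegenerate symmetric bilinear form for which `A` is symmetric. -/
def secondOrderMatrix {n : ℕ} (g A : Matrix (Fin n) (Fin n) ℝ) :
    Matrix (Fin n ⊕ Fin n) (Fin n ⊕ Fin n) ℝ :=
  fromBlocks 0 g⁻¹ (g * A) 0

/-- `m` is the Maslov index on `[0, T]` of `v'' = A v` with respect to `g`. -/
def IsSecondOrderMaslovIndex {n : ℕ} (g A : Matrix (Fin n) (Fin n) ℝ) (T : ℝ) (m : ℤ) : Prop :=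
  IsSymplecticMaslovIndex (secondOrderMatrix g A) T m

/-- The Maslov index `μ(g, A, T)` of `v'' = A v` on `[0, T]`. -/
def secondOrderMaslovIndex {n : ℕ} (g A : Matrix (Fin n) (Fin n) ℝ) (T : ℝ) : ℤ :=
  symplecticMaslovIndex (secondOrderMatrix g A) T

end ConstSympl

end

namespace ConstSympl

open Matrix Set

variable {n : ℕ}

/-! ### Symplectic isomorphisms fixing `L₀` preserve the Maslov index -/

/-! The first row of the system reads `v' = 𝔄v + 𝔅α`, so the momentum `g v'` of the second order
system is `α + 𝔅⁻¹𝔄v`. Hence the shear `P(v, α) = (v, α + 𝔅⁻¹𝔄v)` conjugates `X` to the matrix of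
`v'' = Av` (`shearMatrix_mul_fromBlocks`). It is symplectic because `𝔅⁻¹𝔄` is symmetric, and it
fixes `L₀` pointwise, so it carries one curve of Lagrangians to the other
(`lagrangianCurve_eq_map_shear`).

Such a `P` preserves the intersections with `L₀` up to isomorphism, and it preserves the form
`φ_{L₀,L₁}(L)` exactly when `L₁` and `L` are moved together (`extendedCoindex_map`). Admissible data
for one curve therefore become admissible data for the other with the same sum, and both curves have
exactly the same integers as index sums. Independence of the sum from the subdivision is never
needed.

Two points remain. Admissible subdivisions exist by compactness, since every Lagrangian is
transversal to some `{(v, cv)}` (`exists_diagonalLagrangian_inf_eq_bot`). The multiplicities agree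
because `v ↦ (v, g v')` turns solutions of `v'' = Av` into orbits of the flow
(`conjugateSolutions_eq_map`). -/

theorem IsLagrangian.isCompl {L L' : Submodule ℝ (PhaseSpace n)} (hL : IsLagrangian L)
    (hL' : IsLagrangian L') (h : L ⊓ L' = ⊥) : IsCompl L L' := by
  rw [Submodule.isCompl_iff_disjoint, disjoint_iff]
  · exact h
  · simp [hL.1, hL'.1]

theorem IsLagrangian.map {L : Submodule ℝ (PhaseSpace n)} (hL : IsLagrangian L)
    (P : PhaseSpace n ≃ₗ[ℝ] PhaseSpace n)
    (hP : ∀ x y, symplecticForm n (P x) (P y) = symplecticForm n x y) :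
    IsLagrangian (L.map (P : PhaseSpace n →ₗ[ℝ] PhaseSpace n)) := by
  refine ⟨by rw [LinearEquiv.finrank_map_eq, hL.1], ?_⟩
  rintro _ ⟨x, hx, rfl⟩ _ ⟨y, hy, rfl⟩
  simpa [hP] using hL.2 x hx y hy

theorem map_inf_map_eq_bot {L L' : Submodule ℝ (PhaseSpace n)} (h : L ⊓ L' = ⊥)
    (P : PhaseSpace n ≃ₗ[ℝ] PhaseSpace n) :
    L.map (P : PhaseSpace n →ₗ[ℝ] PhaseSpace n) ⊓
      L'.map (P : PhaseSpace n →ₗ[ℝ] PhaseSpace n) = ⊥ := by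
  rw [← Submodule.map_inf _ P.injective, h, Submodule.map_bot]

theorem map_eq_self {L₀ : Submodule ℝ (PhaseSpace n)} {P : PhaseSpace n ≃ₗ[ℝ] PhaseSpace n}
    (h₀ : ∀ x ∈ L₀, P x = x) : L₀.map (P : PhaseSpace n →ₗ[ℝ] PhaseSpace n) = L₀ := by
  ext z
  constructor
  · rintro ⟨x, hx, rfl⟩
    simpa [h₀ x hx] using hx
  · exact fun hz => ⟨z, hz, h₀ z hz⟩

/-- The map is minus the projection onto `L₁` along `L`: subtracting from `x` its `L₁`-component
leaves a vector of `L`. -/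
theorem exists_isGraphOf {L₀ L₁ L : Submodule ℝ (PhaseSpace n)} (h₀ : IsCompl L₀ L₁)
    (h : IsCompl L₁ L) : ∃ S : L₀ →ₗ[ℝ] L₁, IsGraphOf S L := by
  refine ⟨-(L₁.projectionOnto L h ∘ₗ L₀.subtype), fun z => ⟨fun hz => ?_, ?_⟩⟩
  · obtain ⟨x, y, rfl, -⟩ := Submodule.existsUnique_add_of_isCompl h₀ z
    refine ⟨x, ?_⟩
    have h1 : L₁.projectionOnto L h ((x : PhaseSpace n) + y) = 0 :=
      (Submodule.projectionOnto_apply_eq_zero_iff h).2 hz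
    rw [map_add, Submodule.projectionOnto_apply_left] at h1
    simp [eq_neg_of_add_eq_zero_left h1]
  · rintro ⟨x, rfl⟩
    change (x : PhaseSpace n) + ((-L₁.projectionOnto L h x : L₁) : PhaseSpace n) ∈ L
    rw [Submodule.coe_neg, ← sub_eq_add_neg, Submodule.coe_projectionOnto_apply]
    exact Submodule.sub_projection_mem h _

theorem IsGraphOf.unique {L₀ L₁ L : Submodule ℝ (PhaseSpace n)} (h₀ : L₀ ⊓ L₁ = ⊥)
    {S S' : L₀ →ₗ[ℝ] L₁} (hS : IsGraphOf S L) (hS' : IsGraphOf S' L) : S = S' := by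
  ext1 x
  obtain ⟨x', hx'⟩ := (hS' _).1 ((hS _).2 ⟨x, rfl⟩)
  have hmem : (x' : PhaseSpace n) - x ∈ L₀ ⊓ L₁ := by
    refine ⟨L₀.sub_mem x'.2 x.2, ?_⟩
    have : (x' : PhaseSpace n) - x = S x - S' x' := by linear_combination hx'
    rw [this]
    exact L₁.sub_mem (S x).2 (S' x').2
  rw [h₀, Submodule.mem_bot, sub_eq_zero] at hmem
  obtain rfl := Subtype.ext hmem
  exact Subtype.ext (add_left_cancel hx').symm

theorem isGraphOf_graphMap {L₀ L₁ L : Submodule ℝ (PhaseSpace n)} (h₀ : IsCompl L₀ L₁)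
    (h : IsCompl L₁ L) : IsGraphOf (graphMap L₀ L₁ L) L :=
  Classical.epsilon_spec (exists_isGraphOf h₀ h)

theorem graphMap_eq {L₀ L₁ L : Submodule ℝ (PhaseSpace n)} (h₀ : IsCompl L₀ L₁)
    {S : L₀ →ₗ[ℝ] L₁} (hS : IsGraphOf S L) : graphMap L₀ L₁ L = S :=
  IsGraphOf.unique h₀.inf_eq_bot (Classical.epsilon_spec (p := fun S => IsGraphOf S L) ⟨S, hS⟩) hS

/-- As `P` fixes `L₀` pointwise, it sends the graph of `S` to the graph of `P ∘ S`; and for `x`, `y`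
in `L₀`, `ω(PSx, y) = ω(PSx, Py) = ω(Sx, y)`. The chart form is thus literally unchanged. -/
theorem extendedCoindex_map {L₀ L₁ L : Submodule ℝ (PhaseSpace n)} (h₀ : IsCompl L₀ L₁)
    (h : IsCompl L₁ L) {P : PhaseSpace n ≃ₗ[ℝ] PhaseSpace n}
    (hP : ∀ x y, symplecticForm n (P x) (P y) = symplecticForm n x y)
    (hP₀ : ∀ x ∈ L₀, P x = x) :
    extendedCoindex L₀ (L₁.map (P : PhaseSpace n →ₗ[ℝ] PhaseSpace n))
      (L.map (P : PhaseSpace n →ₗ[ℝ] PhaseSpace n)) = extendedCoindex L₀ L₁ L := by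
  set S := graphMap L₀ L₁ L with hS
  have hgraph : IsGraphOf ((P.submoduleMap L₁).toLinearMap ∘ₗ S)
      (L.map (P : PhaseSpace n →ₗ[ℝ] PhaseSpace n)) := by
    intro z
    have hPx (x : L₀) : (x : PhaseSpace n) + P (S x) = P (x + S x) := by
      rw [map_add, hP₀ x x.2]
    constructor
    · rintro ⟨y, hy, rfl⟩
      obtain ⟨x, rfl⟩ := (isGraphOf_graphMap h₀ h _).1 hy
      exact ⟨x, hPx x⟩
    · rintro ⟨x, rfl⟩
      exact ⟨_, (isGraphOf_graphMap h₀ h _).2 ⟨x, rfl⟩, (hPx x).symm⟩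
  have h₀' : IsCompl L₀ (L₁.map (P : PhaseSpace n →ₗ[ℝ] PhaseSpace n)) := by
    have := h₀.map (Submodule.orderIsoMapComap P)
    change IsCompl (L₀.map (P : PhaseSpace n →ₗ[ℝ] PhaseSpace n)) (L₁.map _) at this
    rwa [map_eq_self hP₀] at this
  have hform : chartForm L₀ (L₁.map (P : PhaseSpace n →ₗ[ℝ] PhaseSpace n))
      (L.map (P : PhaseSpace n →ₗ[ℝ] PhaseSpace n)) = chartForm L₀ L₁ L := by
    refine LinearMap.ext₂ fun x y => ?_
    rw [chartForm, graphMap_eq h₀' hgraph]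
    change symplecticForm n (P (S x)) y = symplecticForm n (S x) y
    rw [← hP (S x) y, hP₀ y y.2]
  have hinf : L.map (P : PhaseSpace n →ₗ[ℝ] PhaseSpace n) ⊓ L₀ =
      (L ⊓ L₀).map (P : PhaseSpace n →ₗ[ℝ] PhaseSpace n) := by
    rw [Submodule.map_inf _ P.injective, map_eq_self hP₀]
  rw [extendedCoindex, extendedCoindex, hform, hinf, LinearEquiv.finrank_map_eq]

theorem IsMaslovIndex.map {L₀ : Submodule ℝ (PhaseSpace n)} {ℓ : ℝ → Submodule ℝ (PhaseSpace n)}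
    {a b : ℝ} {m : ℤ} (hL₀ : IsLagrangian L₀) (hℓ : ∀ s, IsLagrangian (ℓ s))
    {P : PhaseSpace n ≃ₗ[ℝ] PhaseSpace n}
    (hP : ∀ x y, symplecticForm n (P x) (P y) = symplecticForm n x y)
    (hP₀ : ∀ x ∈ L₀, P x = x) (hm : IsMaslovIndex L₀ ℓ a b m) :
    IsMaslovIndex L₀ (fun s => (ℓ s).map (P : PhaseSpace n →ₗ[ℝ] PhaseSpace n)) a b m := by
  obtain ⟨k, t, L₁, ht, h0, hk, hL₁, rfl⟩ := hm
  refine ⟨k, t, fun i => (L₁ i).map (P : PhaseSpace n →ₗ[ℝ] PhaseSpace n), ht, h0, hk,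
    fun i hi => ?_, ?_⟩
  · obtain ⟨h1, h2, h3⟩ := hL₁ i hi
    refine ⟨h1.map P hP, ?_, fun s hs => map_inf_map_eq_bot (h3 s hs) P⟩
    conv_lhs => rw [← map_eq_self hP₀]
    exact map_inf_map_eq_bot h2 P
  · refine Finset.sum_congr rfl fun i hi => ?_
    obtain ⟨h1, h2, h3⟩ := hL₁ i (Finset.mem_range.1 hi)
    have hc := (h1.isCompl hL₀ h2).symm
    have hle := ht (Nat.le_succ i)
    rw [extendedCoindex_map hc (h1.isCompl (hℓ _) (h3 _ ⟨hle, le_rfl⟩)) hP hP₀,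
      extendedCoindex_map hc (h1.isCompl (hℓ _) (h3 _ ⟨le_rfl, hle⟩)) hP hP₀]

theorem isMaslovIndex_map_iff {L₀ : Submodule ℝ (PhaseSpace n)}
    {ℓ : ℝ → Submodule ℝ (PhaseSpace n)} {a b : ℝ} {m : ℤ} (hL₀ : IsLagrangian L₀)
    (hℓ : ∀ s, IsLagrangian (ℓ s)) {P : PhaseSpace n ≃ₗ[ℝ] PhaseSpace n}
    (hP : ∀ x y, symplecticForm n (P x) (P y) = symplecticForm n x y)
    (hP₀ : ∀ x ∈ L₀, P x = x) :
    IsMaslovIndex L₀ (fun s => (ℓ s).map (P : PhaseSpace n →ₗ[ℝ] PhaseSpace n)) a b m ↔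
      IsMaslovIndex L₀ ℓ a b m := by
  refine ⟨fun h => ?_, fun h => h.map hL₀ hℓ hP hP₀⟩
  -- The inverse is again symplectic and fixes `L₀`, so the converse is the forward direction for
  -- `P.symm`.
  have := h.map (P := P.symm) hL₀ (fun s => (hℓ s).map P hP)
    (fun x y => by rw [← hP]; simp) (fun x hx => by rw [LinearEquiv.symm_apply_eq, hP₀ x hx])
  simpa [← Submodule.map_comp] using this

/-! ### Lagrangian complements of `{0} ⊕ (ℝⁿ)*` -/

theorem mem_verticalLagrangian {z : PhaseSpace n} :
    z ∈ verticalLagrangian n ↔ ∀ i, z (Sum.inl i) = 0 := Iff.rfl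

/-- The inclusion of `(ℝⁿ)*` into the phase space. -/
def verticalInclusion (n : ℕ) : (Fin n → ℝ) →ₗ[ℝ] PhaseSpace n where
  toFun α := Sum.elim 0 α
  map_add' α β := by ext (i | i) <;> simp
  map_smul' c α := by ext (i | i) <;> simp

theorem verticalInclusion_injective : Function.Injective (verticalInclusion n) :=
  fun _ _ h => funext fun i => congrFun h (Sum.inr i)

theorem range_verticalInclusion : LinearMap.range (verticalInclusion n) = verticalLagrangian n := by
  ext z
  constructor
  · rintro ⟨α, rfl⟩ i
    rfl
  · intro hz
    refine ⟨fun i => z (Sum.inr i), ?_⟩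
    ext (i | i)
    · exact (hz i).symm
    · rfl

theorem isLagrangian_verticalLagrangian : IsLagrangian (verticalLagrangian n) := by
  rw [← range_verticalInclusion]
  refine ⟨by simp [LinearMap.finrank_range_of_inj verticalInclusion_injective], ?_⟩
  rintro _ ⟨α, rfl⟩ _ ⟨β, rfl⟩
  exact (symplecticForm_apply n 0 α 0 β).trans (by simp)

/-- The map `v ↦ (v, c v)`. -/
def diagonalInclusion (n : ℕ) (c : ℝ) : (Fin n → ℝ) →ₗ[ℝ] PhaseSpace n where
  toFun v := Sum.elim v (c • v)
  map_add' α β := by ext (i | i) <;> simp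
  map_smul' d α := by ext (i | i) <;> simp [mul_left_comm]

/-- The Lagrangian `{(v, c v)}`. -/
def diagonalLagrangian (n : ℕ) (c : ℝ) : Submodule ℝ (PhaseSpace n) :=
  LinearMap.range (diagonalInclusion n c)

theorem diagonalInclusion_injective (c : ℝ) : Function.Injective (diagonalInclusion n c) :=
  fun _ _ h => funext fun i => congrFun h (Sum.inl i)

theorem mem_diagonalLagrangian {c : ℝ} {z : PhaseSpace n} :
    z ∈ diagonalLagrangian n c ↔ ∀ i, z (Sum.inr i) = c * z (Sum.inl i) := by
  constructor
  · rintro ⟨v, rfl⟩ i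
    rfl
  · intro hz
    refine ⟨fun i => z (Sum.inl i), ?_⟩
    ext (i | i)
    · rfl
    · exact (hz i).symm

theorem symplecticForm_diagonalInclusion (c d : ℝ) (v w : Fin n → ℝ) :
    symplecticForm n (diagonalInclusion n c v) (diagonalInclusion n d w) =
      (d - c) * (v ⬝ᵥ w) := by
  refine (symplecticForm_apply n v (c • v) w (d • w)).trans ?_
  rw [smul_dotProduct, smul_dotProduct, dotProduct_comm w v, smul_eq_mul, smul_eq_mul, sub_mul]

theorem isLagrangian_diagonalLagrangian (c : ℝ) : IsLagrangian (diagonalLagrangian n c) := by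
  refine ⟨(LinearMap.finrank_range_of_inj (diagonalInclusion_injective c)).trans (by simp), ?_⟩
  rintro _ ⟨v, rfl⟩ _ ⟨w, rfl⟩
  simp [symplecticForm_diagonalInclusion]

theorem diagonalLagrangian_inf_verticalLagrangian (c : ℝ) :
    diagonalLagrangian n c ⊓ verticalLagrangian n = ⊥ := by
  rw [eq_bot_iff]
  rintro z ⟨hz, hz'⟩
  have h := mem_diagonalLagrangian.1 hz
  ext (i | i)
  · exact hz' i
  · simp [h i, mem_verticalLagrangian.1 hz' i]

/-- If `(v, cv)` and `(w, dw)` both lie in `L`, then `(d - c)⟨v, w⟩ = 0`. Distinct slopes thus give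
orthogonal vectors, and at most `n` slopes can meet `L` nontrivially. -/
theorem exists_diagonalLagrangian_inf_eq_bot {L : Submodule ℝ (PhaseSpace n)}
    (hL : IsLagrangian L) : ∃ c, diagonalLagrangian n c ⊓ L = ⊥ := by
  by_contra! h
  -- The slopes `0, …, n` are one more than the dimension allows.
  have h' (c : Fin (n + 1)) : ∃ v : Fin n → ℝ, v ≠ 0 ∧ diagonalInclusion n (c : ℕ) v ∈ L := by
    obtain ⟨_, ⟨⟨v, rfl⟩, hv⟩, h0⟩ := Submodule.exists_mem_ne_zero_of_ne_bot (h (c : ℕ))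
    exact ⟨v, fun hv0 => h0 (by simp [hv0]), hv⟩
  choose v hv0 hv using h'
  have hli : LinearIndependent ℝ fun c => WithLp.toLp 2 (v c) := by
    refine linearIndependent_of_ne_zero_of_inner_eq_zero (𝕜 := ℝ) (fun c => by simpa using hv0 c)
      fun c d hcd => ?_
    have hω := hL.2 _ (hv c) _ (hv d)
    rw [symplecticForm_diagonalInclusion] at hω
    have hne : ((d : ℕ) : ℝ) - ((c : ℕ) : ℝ) ≠ 0 := by
      rw [sub_ne_zero]
      exact_mod_cast fun h : (d : ℕ) = c => hcd (Fin.ext h.symm)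
    simpa [EuclideanSpace.inner_eq_star_dotProduct, dotProduct_comm] using
      (mul_eq_zero.1 hω).resolve_left hne
  have := hli.fintype_card_le_finrank
  simp at this

/-! ### Hamiltonian matrices -/

/-- The matrix of the canonical symplectic form. -/
def formMatrix (n : ℕ) : Matrix (Fin n ⊕ Fin n) (Fin n ⊕ Fin n) ℝ :=
  fromBlocks 0 1 (-1) 0

/-- `X` is in the Lie algebra `sp(2n, ℝ)`. -/
def IsHamiltonian (X : Matrix (Fin n ⊕ Fin n) (Fin n ⊕ Fin n) ℝ) : Prop :=
  formMatrix n * X = -Xᵀ * formMatrix n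

theorem isUnit_formMatrix : IsUnit (formMatrix n) :=
  IsUnit.of_mul_eq_one (-formMatrix n) (by simp [formMatrix, fromBlocks_multiply, fromBlocks_neg])

theorem isHamiltonian_fromBlocks {a b c : Matrix (Fin n) (Fin n) ℝ} (hb : b.IsSymm)
    (hc : c.IsSymm) : IsHamiltonian (fromBlocks a b c (-aᵀ)) := by
  simp [IsHamiltonian, formMatrix, fromBlocks_multiply, fromBlocks_transpose, fromBlocks_neg,
    hb.eq, hc.eq]

theorem symplecticForm_mulVec {M : Matrix (Fin n ⊕ Fin n) (Fin n ⊕ Fin n) ℝ}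
    (hM : Mᵀ * formMatrix n * M = formMatrix n) (x y : PhaseSpace n) :
    symplecticForm n (M *ᵥ x) (M *ᵥ y) = symplecticForm n x y := by
  have h := Matrix.toBilin'_comp (formMatrix n) M M
  rw [hM] at h
  exact LinearMap.congr_fun₂ h x y

theorem mul_exp_eq_exp_mul {m : Type*} [Fintype m] [DecidableEq m] {U X Y : Matrix m m ℝ}
    (hU : IsUnit U) (h : U * X = Y * U) :
    U * NormedSpace.exp X = NormedSpace.exp Y * U := by
  have hd := (Matrix.isUnit_iff_isUnit_det U).1 hU
  have hY : Y = U * X * U⁻¹ := by rw [h, Matrix.mul_nonsing_inv_cancel_right _ _ hd]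
  rw [hY, Matrix.exp_conj U X hU, Matrix.nonsing_inv_mul_cancel_right _ _ hd]

theorem fundamentalSolution_neg_mul (X : Matrix (Fin n ⊕ Fin n) (Fin n ⊕ Fin n) ℝ) (t : ℝ) :
    fundamentalSolution X (-t) * fundamentalSolution X t = 1 := by
  rw [fundamentalSolution, fundamentalSolution, neg_smul, Matrix.exp_neg]
  exact Matrix.nonsing_inv_mul _ ((Matrix.isUnit_iff_isUnit_det _).1 (Matrix.isUnit_exp _))

theorem fundamentalSolution_mul_neg (X : Matrix (Fin n ⊕ Fin n) (Fin n ⊕ Fin n) ℝ) (t : ℝ) :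
    fundamentalSolution X t * fundamentalSolution X (-t) = 1 := by
  simpa using fundamentalSolution_neg_mul X (-t)

/-- The relation `JX = -XᵀJ` exponentiates to `J exp(tX) = exp(-tXᵀ) J`, and `exp(-tXᵀ)` is the
inverse of `Φ(t)ᵀ`. -/
theorem IsHamiltonian.transpose_fundamentalSolution_mul
    {X : Matrix (Fin n ⊕ Fin n) (Fin n ⊕ Fin n) ℝ} (hX : IsHamiltonian X) (t : ℝ) :
    (fundamentalSolution X t)ᵀ * formMatrix n * fundamentalSolution X t = formMatrix n := by
  have h : formMatrix n * (t • X) = (-(t • Xᵀ)) * formMatrix n := by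
    rw [Matrix.mul_smul, hX, neg_mul, neg_mul, smul_neg, Matrix.smul_mul]
  have h1 := mul_exp_eq_exp_mul isUnit_formMatrix h
  have h2 : (fundamentalSolution X t)ᵀ = fundamentalSolution Xᵀ t := by
    rw [fundamentalSolution, fundamentalSolution, ← Matrix.exp_transpose, transpose_smul]
  have h3 : NormedSpace.exp (-(t • Xᵀ)) = fundamentalSolution Xᵀ (-t) := by
    rw [fundamentalSolution, neg_smul]
  rw [h2, Matrix.mul_assoc]
  change fundamentalSolution Xᵀ t * (formMatrix n * NormedSpace.exp (t • X)) = _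
  rw [h1, h3, ← Matrix.mul_assoc, fundamentalSolution_mul_neg, Matrix.one_mul]

theorem continuous_fundamentalSolution (X : Matrix (Fin n ⊕ Fin n) (Fin n ⊕ Fin n) ℝ) :
    Continuous (fundamentalSolution X) := by
  let _ : NormedRing (Matrix (Fin n ⊕ Fin n) (Fin n ⊕ Fin n) ℝ) := Matrix.linftyOpNormedRing
  let _ : NormedAlgebra ℝ (Matrix (Fin n ⊕ Fin n) (Fin n ⊕ Fin n) ℝ) :=
    Matrix.linftyOpNormedAlgebra
  exact continuous_iff_continuousAt.2 fun t =>
    (hasDerivAt_exp_smul_const' (𝕂 := ℝ) X t).continuousAt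

/-- The linear isomorphism `Φ(t)`. -/
noncomputable def flow (X : Matrix (Fin n ⊕ Fin n) (Fin n ⊕ Fin n) ℝ) (t : ℝ) :
    PhaseSpace n ≃ₗ[ℝ] PhaseSpace n :=
  Matrix.toLin'OfInv (fundamentalSolution_neg_mul X t) (fundamentalSolution_mul_neg X t)

theorem flow_apply (X : Matrix (Fin n ⊕ Fin n) (Fin n ⊕ Fin n) ℝ) (t : ℝ) (z : PhaseSpace n) :
    flow X t z = fundamentalSolution X t *ᵥ z := rfl

theorem lagrangianCurve_eq_map_flow (X : Matrix (Fin n ⊕ Fin n) (Fin n ⊕ Fin n) ℝ) (t : ℝ) :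
    lagrangianCurve X t =
      (verticalLagrangian n).map (flow X t : PhaseSpace n →ₗ[ℝ] PhaseSpace n) := rfl

theorem IsHamiltonian.isLagrangian_lagrangianCurve
    {X : Matrix (Fin n ⊕ Fin n) (Fin n ⊕ Fin n) ℝ} (hX : IsHamiltonian X) (t : ℝ) :
    IsLagrangian (lagrangianCurve X t) :=
  isLagrangian_verticalLagrangian.map (flow X t)
    (symplecticForm_mulVec (hX.transpose_fundamentalSolution_mul t))

/-! ### Existence of admissible subdivisions -/

/-- Since `Φ(t)(0, α) = (Φ₁₂α, Φ₂₂α)`, this vector lies on the diagonal of slope `c` exactly when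
`(Φ₂₂ - cΦ₁₂)α = 0`. Transversality becomes an open condition on `t`. -/
theorem diagonalLagrangian_inf_lagrangianCurve_eq_bot_iff
    (X : Matrix (Fin n ⊕ Fin n) (Fin n ⊕ Fin n) ℝ) (t c : ℝ) :
    diagonalLagrangian n c ⊓ lagrangianCurve X t = ⊥ ↔
      ((fundamentalSolution X t).toBlocks₂₂ - c • (fundamentalSolution X t).toBlocks₁₂).det ≠ 0 := by
  set D := (fundamentalSolution X t).toBlocks₂₂ - c • (fundamentalSolution X t).toBlocks₁₂
  have hflow (α : Fin n → ℝ) : flow X t (verticalInclusion n α) =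
      Sum.elim ((fundamentalSolution X t).toBlocks₁₂ *ᵥ α)
        ((fundamentalSolution X t).toBlocks₂₂ *ᵥ α) := by
    rw [flow_apply]
    change fundamentalSolution X t *ᵥ Sum.elim 0 α = _
    conv_lhs => rw [← fromBlocks_toBlocks (fundamentalSolution X t)]
    simp [fromBlocks_mulVec]
  have hmem (α : Fin n → ℝ) :
      flow X t (verticalInclusion n α) ∈ diagonalLagrangian n c ↔ D *ᵥ α = 0 := by
    rw [mem_diagonalLagrangian, hflow, sub_mulVec, sub_eq_zero, smul_mulVec, funext_iff]
    rfl
  rw [← not_iff_not, not_not, ← Matrix.exists_mulVec_eq_zero_iff]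
  constructor
  · intro h
    obtain ⟨_, ⟨hz, ⟨y, hy, rfl⟩⟩, h0⟩ := Submodule.exists_mem_ne_zero_of_ne_bot h
    rw [SetLike.mem_coe, ← range_verticalInclusion] at hy
    obtain ⟨α, rfl⟩ := hy
    exact ⟨α, fun hα => h0 (by simp [hα]), (hmem α).1 hz⟩
  · rintro ⟨α, hα, hD⟩ h
    have hz : flow X t (verticalInclusion n α) ∈ diagonalLagrangian n c ⊓ lagrangianCurve X t :=
      ⟨(hmem α).2 hD, _, by rw [← range_verticalInclusion]; exact ⟨α, rfl⟩, rfl⟩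
    rw [h, Submodule.mem_bot, LinearEquiv.map_eq_zero_iff] at hz
    exact hα (verticalInclusion_injective (hz.trans (map_zero _).symm))

theorem isOpen_diagonalLagrangian_inf_lagrangianCurve_eq_bot
    (X : Matrix (Fin n ⊕ Fin n) (Fin n ⊕ Fin n) ℝ) (c : ℝ) :
    IsOpen {t | diagonalLagrangian n c ⊓ lagrangianCurve X t = ⊥} := by
  simp_rw [diagonalLagrangian_inf_lagrangianCurve_eq_bot_iff]
  have h := continuous_fundamentalSolution X
  refine isOpen_ne_fun (Continuous.matrix_det (Continuous.sub ?_ (Continuous.const_smul ?_ c)))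
    continuous_const
  · exact h.matrix_submatrix Sum.inr Sum.inr
  · exact h.matrix_submatrix Sum.inl Sum.inr

/-- The instants at which a given diagonal is transversal to the curve form an open set, and these
sets cover `[a, b]`; a fine enough subdivision keeps one diagonal transversal on each piece. -/
theorem IsHamiltonian.exists_isMaslovIndex {X : Matrix (Fin n ⊕ Fin n) (Fin n ⊕ Fin n) ℝ}
    (hX : IsHamiltonian X) {a b : ℝ} (hab : a ≤ b) :
    ∃ m, IsMaslovIndex (verticalLagrangian n) (lagrangianCurve X) a b m := by
  obtain ⟨t, h0, ht, ⟨k, hk⟩, hc⟩ := exists_monotone_Icc_subset_open_cover_Icc hab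
    (c := fun c : ℝ => {s : Icc a b | diagonalLagrangian n c ⊓ lagrangianCurve X s = ⊥})
    (fun c => (isOpen_diagonalLagrangian_inf_lagrangianCurve_eq_bot X c).preimage
      continuous_subtype_val)
    (fun s _ => mem_iUnion.2
      (exists_diagonalLagrangian_inf_eq_bot (hX.isLagrangian_lagrangianCurve s)))
  choose c hc using hc
  refine ⟨_, k, fun i => (t i : ℝ), fun i => diagonalLagrangian n (c i), fun i j hij => ht hij, h0,
    hk k le_rfl, fun i _ => ⟨isLagrangian_diagonalLagrangian _,
      diagonalLagrangian_inf_verticalLagrangian _, fun s hs => ?_⟩, rfl⟩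
  have hs' : s ∈ Icc a b := ⟨(t i).2.1.trans hs.1, hs.2.trans (t (i + 1)).2.2⟩
  exact hc i (a := ⟨s, hs'⟩) ⟨hs.1, hs.2⟩

/-! ### Solutions of the second order system -/

theorem hasDerivAt_flow (X : Matrix (Fin n ⊕ Fin n) (Fin n ⊕ Fin n) ℝ) (z : PhaseSpace n) (t : ℝ) :
    HasDerivAt (fun s => flow X s z) (X *ᵥ flow X t z) t := by
  let _ : NormedRing (Matrix (Fin n ⊕ Fin n) (Fin n ⊕ Fin n) ℝ) := Matrix.linftyOpNormedRing
  let _ : NormedAlgebra ℝ (Matrix (Fin n ⊕ Fin n) (Fin n ⊕ Fin n) ℝ) :=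
    Matrix.linftyOpNormedAlgebra
  have h := ((Matrix.mulVecBilin ℝ ℝ).flip z).toContinuousLinearMap.hasFDerivAt.comp_hasDerivAt t
    (hasDerivAt_exp_smul_const' (𝕂 := ℝ) X t)
  rw [flow_apply, mulVec_mulVec]
  exact h

theorem hasDerivWithinAt_mulVec {m p : Type*} [Fintype m] [Fintype p] (M : Matrix p m ℝ)
    {f : ℝ → m → ℝ} {f' : m → ℝ} {s : Set ℝ} {t : ℝ} (hf : HasDerivWithinAt f f' s t) :
    HasDerivWithinAt (fun u => M *ᵥ f u) (M *ᵥ f') s t :=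
  M.mulVecLin.toContinuousLinearMap.hasFDerivAt.comp_hasDerivWithinAt t hf

theorem flow_zero (X : Matrix (Fin n ⊕ Fin n) (Fin n ⊕ Fin n) ℝ) (z : PhaseSpace n) :
    flow X 0 z = z := by
  rw [flow_apply, fundamentalSolution_zero, one_mulVec]

theorem eqOn_flow {X : Matrix (Fin n ⊕ Fin n) (Fin n ⊕ Fin n) ℝ} {T : ℝ} {z : ℝ → PhaseSpace n}
    (hz : ∀ t ∈ Icc 0 T, HasDerivWithinAt z (X *ᵥ z t) (Icc 0 T) t) :
    EqOn z (fun t => flow X t (z 0)) (Icc 0 T) := by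
  refine ODE_solution_unique (v := fun _ y => X *ᵥ y)
    (fun _ => X.mulVecLin.toContinuousLinearMap.lipschitz)
    (fun t ht => (hz t ht).continuousWithinAt) (fun t ht => ?_)
    (fun t _ => (hasDerivAt_flow X (z 0) t).continuousAt.continuousWithinAt)
    (fun t _ => (hasDerivAt_flow X (z 0) t).hasDerivWithinAt) (flow_zero X (z 0)).symm
  -- The uniqueness theorem asks for right derivatives at `t < T`, where `[0, T]` is a right
  -- neighbourhood of `t`.
  exact (hz t (Ico_subset_Icc_self ht)).mono_of_mem_nhdsWithin (Icc_mem_nhdsGE_of_mem ht)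

theorem secondOrderMatrix_mulVec (g A : Matrix (Fin n) (Fin n) ℝ) (z : PhaseSpace n) :
    secondOrderMatrix g A *ᵥ z =
      Sum.elim (g⁻¹ *ᵥ (z ∘ Sum.inr)) (g *ᵥ (A *ᵥ (z ∘ Sum.inl))) := by
  simp [secondOrderMatrix, fromBlocks_mulVec, mulVec_mulVec]

/-- The `v`-component on `I` of the solution of the symplectic system with initial value `z`. -/
noncomputable def positionMap (X : Matrix (Fin n ⊕ Fin n) (Fin n ⊕ Fin n) ℝ) (I : Set ℝ) :
    PhaseSpace n →ₗ[ℝ] (I → Fin n → ℝ) where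
  toFun z s := flow X s z ∘ Sum.inl
  map_add' x y := by ext; simp
  map_smul' c x := by ext; simp

theorem hasDerivAt_flow_inl (g A : Matrix (Fin n) (Fin n) ℝ) (z : PhaseSpace n) (t : ℝ) :
    HasDerivAt (fun s => flow (secondOrderMatrix g A) s z ∘ Sum.inl)
      (g⁻¹ *ᵥ (flow (secondOrderMatrix g A) t z ∘ Sum.inr)) t := by
  have h := hasDerivAt_flow (secondOrderMatrix g A) z t
  rw [secondOrderMatrix_mulVec] at h
  exact hasDerivAt_pi.2 fun i => hasDerivAt_pi.1 h (Sum.inl i)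

theorem hasDerivAt_flow_inr (g A : Matrix (Fin n) (Fin n) ℝ) (z : PhaseSpace n) (t : ℝ) :
    HasDerivAt (fun s => flow (secondOrderMatrix g A) s z ∘ Sum.inr)
      (g *ᵥ (A *ᵥ (flow (secondOrderMatrix g A) t z ∘ Sum.inl))) t := by
  have h := hasDerivAt_flow (secondOrderMatrix g A) z t
  rw [secondOrderMatrix_mulVec] at h
  exact hasDerivAt_pi.2 fun i => hasDerivAt_pi.1 h (Sum.inr i)

/-- If the position vanishes on `[0, T]`, so does its one-sided derivative `g⁻¹α(0)` at `0`, which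
is determined because `T > 0`. -/
theorem positionMap_injective {g : Matrix (Fin n) (Fin n) ℝ} (hg : IsUnit g)
    (A : Matrix (Fin n) (Fin n) ℝ) {T : ℝ} (hT : 0 < T) :
    Function.Injective (positionMap (secondOrderMatrix g A) (Icc 0 T)) := by
  rw [← LinearMap.ker_eq_bot, LinearMap.ker_eq_bot']
  intro z hz
  have hpos : ∀ s ∈ Icc 0 T, flow (secondOrderMatrix g A) s z ∘ Sum.inl = 0 :=
    fun s hs => congrFun hz ⟨s, hs⟩
  have h0 : (0 : ℝ) ∈ Icc 0 T := ⟨le_rfl, hT.le⟩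
  have hd := ((hasDerivAt_flow_inl g A z 0).hasDerivWithinAt (s := Icc 0 T)).congr_of_mem
    (f₁ := fun _ => 0) (fun s hs => (hpos s hs).symm) h0
  have hmom := (uniqueDiffOn_Icc hT 0 h0).eq_deriv _ hd (hasDerivWithinAt_const _ _ _)
  have hposz := hpos 0 h0
  rw [flow_zero] at hmom hposz
  have hmom' : z ∘ Sum.inr = 0 := by
    have hdet := (Matrix.isUnit_iff_isUnit_det g).1 hg
    rw [← one_mulVec (z ∘ Sum.inr), ← Matrix.mul_nonsing_inv g hdet, ← mulVec_mulVec, hmom,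
      mulVec_zero]
  ext (i | i)
  · exact congrFun hposz i
  · exact congrFun hmom' i

/-- A solution is the position part of the orbit of `(v, g v')`. Its two boundary conditions say
that the initial value lies in `L₀` and is sent into `L₀` by `Φ(t)`. -/
theorem conjugateSolutions_eq_map {g : Matrix (Fin n) (Fin n) ℝ} (hg : IsUnit g)
    (A : Matrix (Fin n) (Fin n) ℝ) {T t : ℝ} (ht : t ∈ Ioc 0 T) :
    conjugateSolutions A (Icc 0 T) 0 t =
      (verticalLagrangian n ⊓ (verticalLagrangian n).comap
        (flow (secondOrderMatrix g A) t : PhaseSpace n →ₗ[ℝ] PhaseSpace n)).map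
        (positionMap (secondOrderMatrix g A) (Icc 0 T)) := by
  have hdet := (Matrix.isUnit_iff_isUnit_det g).1 hg
  ext u
  constructor
  · rintro ⟨v, rfl, ⟨w, hw⟩, hv0, hvt⟩
    set z : ℝ → PhaseSpace n := fun s => Sum.elim (v s) (g *ᵥ w s) with hz
    have hflow : EqOn z (fun s => flow (secondOrderMatrix g A) s (z 0)) (Icc 0 T) := by
      refine eqOn_flow fun s hs => ?_
      rw [secondOrderMatrix_mulVec, hasDerivWithinAt_pi]
      have h2 := hasDerivWithinAt_mulVec g (hw s hs).2
      rintro (i | i)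
      · have h1 := hasDerivWithinAt_pi.1 (hw s hs).1 i
        simpa [hz, mulVec_mulVec, Matrix.nonsing_inv_mul g hdet] using h1
      · exact hasDerivWithinAt_pi.1 h2 i
    refine ⟨z 0, ⟨fun i => congrFun hv0 i, fun i => ?_⟩, ?_⟩
    · refine (congrFun (hflow ⟨ht.1.le, ht.2⟩) (Sum.inl i)).symm.trans ?_
      exact congrFun hvt i
    · ext s i
      exact (congrFun (hflow s.2) (Sum.inl i)).symm
  · rintro ⟨z, ⟨hz0, hzt⟩, rfl⟩
    refine ⟨fun s => flow (secondOrderMatrix g A) s z ∘ Sum.inl, rfl,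
      ⟨fun s => g⁻¹ *ᵥ (flow (secondOrderMatrix g A) s z ∘ Sum.inr), fun s _ =>
        ⟨(hasDerivAt_flow_inl g A z s).hasDerivWithinAt, ?_⟩⟩, ?_, funext hzt⟩
    · have h := hasDerivWithinAt_mulVec g⁻¹
        ((hasDerivAt_flow_inr g A z s).hasDerivWithinAt (s := Icc 0 T))
      rwa [mulVec_mulVec, Matrix.nonsing_inv_mul g hdet, one_mulVec] at h
    · funext i
      change flow _ 0 z (Sum.inl i) = 0
      rw [flow_zero]
      exact hz0 i

/-- Both spaces are injective images of the same space of initial values, one under `positionMap`,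
the other under `Φ(t)`. -/
theorem nonempty_conjugateSolutions_equiv {g : Matrix (Fin n) (Fin n) ℝ} (hg : IsUnit g)
    (A : Matrix (Fin n) (Fin n) ℝ) {T t : ℝ} (ht : t ∈ Ioc 0 T) :
    Nonempty (conjugateSolutions A (Icc 0 T) 0 t ≃ₗ[ℝ]
      (lagrangianCurve (secondOrderMatrix g A) t ⊓ verticalLagrangian n :
        Submodule ℝ (PhaseSpace n))) := by
  have h : lagrangianCurve (secondOrderMatrix g A) t ⊓ verticalLagrangian n =
      (verticalLagrangian n ⊓ (verticalLagrangian n).comap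
        (flow (secondOrderMatrix g A) t : PhaseSpace n →ₗ[ℝ] PhaseSpace n)).map
        (flow (secondOrderMatrix g A) t : PhaseSpace n →ₗ[ℝ] PhaseSpace n) := by
    ext z
    constructor
    · rintro ⟨⟨x, hx, rfl⟩, hz⟩
      exact ⟨x, ⟨hx, hz⟩, rfl⟩
    · rintro ⟨x, ⟨hx, hz⟩, rfl⟩
      exact ⟨⟨x, hx, rfl⟩, hz⟩
  rw [h, conjugateSolutions_eq_map hg A ht]
  exact ⟨(Submodule.equivMapOfInjective _ (positionMap_injective hg A (ht.1.trans_le ht.2)) _).symm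
    ≪≫ₗ Submodule.equivMapOfInjective _ (flow (secondOrderMatrix g A) t).injective _⟩

/-! ### The shear that transforms the symplectic system into the second order system -/

/-- The symplectic shear `(v, α) ↦ (v, α + S v)`. -/
def shearMatrix (S : Matrix (Fin n) (Fin n) ℝ) : Matrix (Fin n ⊕ Fin n) (Fin n ⊕ Fin n) ℝ :=
  fromBlocks 1 0 S 1

theorem shearMatrix_mul_neg (S : Matrix (Fin n) (Fin n) ℝ) :
    shearMatrix S * shearMatrix (-S) = 1 := by
  simp [shearMatrix, fromBlocks_multiply]

/-- The linear isomorphism `(v, α) ↦ (v, α + S v)`. -/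
noncomputable def shear (S : Matrix (Fin n) (Fin n) ℝ) : PhaseSpace n ≃ₗ[ℝ] PhaseSpace n :=
  Matrix.toLin'OfInv (by simpa using shearMatrix_mul_neg (-S)) (shearMatrix_mul_neg S)

theorem shear_apply (S : Matrix (Fin n) (Fin n) ℝ) (z : PhaseSpace n) :
    shear S z = shearMatrix S *ᵥ z := rfl

theorem symplecticForm_shear {S : Matrix (Fin n) (Fin n) ℝ} (hS : S.IsSymm) (x y : PhaseSpace n) :
    symplecticForm n (shear S x) (shear S y) = symplecticForm n x y :=
  symplecticForm_mulVec
    (by simp [shearMatrix, formMatrix, fromBlocks_multiply, fromBlocks_transpose, hS.eq]) x y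

theorem shear_apply_of_mem {S : Matrix (Fin n) (Fin n) ℝ} :
    ∀ x ∈ verticalLagrangian n, shear S x = x := by
  intro x hx
  rw [← range_verticalInclusion] at hx
  obtain ⟨α, rfl⟩ := hx
  change shearMatrix S *ᵥ Sum.elim (0 : Fin n → ℝ) α =
    Sum.elim (0 : Fin n → ℝ) α
  simp [shearMatrix, fromBlocks_mulVec]

theorem lagrangianCurve_eq_map_shear {S : Matrix (Fin n) (Fin n) ℝ}
    {X Y : Matrix (Fin n ⊕ Fin n) (Fin n ⊕ Fin n) ℝ} (h : shearMatrix S * X = Y * shearMatrix S)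
    (t : ℝ) : lagrangianCurve Y t =
      (lagrangianCurve X t).map (shear S : PhaseSpace n →ₗ[ℝ] PhaseSpace n) := by
  have hU : IsUnit (shearMatrix S) := IsUnit.of_mul_eq_one _ (shearMatrix_mul_neg S)
  have h1 : shearMatrix S * fundamentalSolution X t = fundamentalSolution Y t * shearMatrix S :=
    mul_exp_eq_exp_mul hU (by rw [Matrix.mul_smul, h, Matrix.smul_mul])
  have h2 (z : PhaseSpace n) : shear S (flow X t z) = flow Y t (shear S z) := by
    rw [shear_apply, shear_apply, flow_apply, flow_apply, mulVec_mulVec, h1, mulVec_mulVec]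
  rw [lagrangianCurve_eq_map_flow, lagrangianCurve_eq_map_flow]
  -- Writing `L₀` as its own image under the shear lets the intertwining relation `h2` apply.
  conv_lhs => rw [← map_eq_self (shear_apply_of_mem (S := S))]
  rw [← Submodule.map_comp, ← Submodule.map_comp]
  congr 1
  exact LinearMap.ext fun z => (h2 z).symm

theorem shearMatrix_mul_fromBlocks {a b c : Matrix (Fin n) (Fin n) ℝ} (hb : b.IsSymm)
    (hunit : IsUnit b) (hS : (b⁻¹ * a).IsSymm) :
    shearMatrix (b⁻¹ * a) * fromBlocks a b c (-aᵀ) =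
      secondOrderMatrix b⁻¹ (b * (aᵀ * b⁻¹ * a + c)) * shearMatrix (b⁻¹ * a) := by
  have hdet := (Matrix.isUnit_iff_isUnit_det b).1 hunit
  -- Symmetry enters here: it gives `b⁻¹ab = aᵀ`, which cancels the lower right block, so the new
  -- momentum equation contains no momentum.
  have hS' : b⁻¹ * a = aᵀ * b⁻¹ := by
    rw [← hS.eq, transpose_mul, transpose_nonsing_inv, hb.eq]
  have h1 : b * (b⁻¹ * a) = a := Matrix.mul_nonsing_inv_cancel_left _ _ hdet
  have h2 : b⁻¹ * a * b = aᵀ := by rw [hS', Matrix.nonsing_inv_mul_cancel_right _ _ hdet]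
  have h3 : b⁻¹ * (b * (b⁻¹ * a * a + c)) = b⁻¹ * a * a + c :=
    Matrix.nonsing_inv_mul_cancel_left _ _ hdet
  simp [shearMatrix, secondOrderMatrix, fromBlocks_multiply, Matrix.nonsing_inv_nonsing_inv b hdet,
    h1, h2, h3, ← hS']

theorem nonempty_lagrangianCurve_inf_equiv {S : Matrix (Fin n) (Fin n) ℝ}
    {X Y : Matrix (Fin n ⊕ Fin n) (Fin n ⊕ Fin n) ℝ} (h : shearMatrix S * X = Y * shearMatrix S)
    (t : ℝ) :
    Nonempty ((lagrangianCurve X t ⊓ verticalLagrangian n : Submodule ℝ (PhaseSpace n)) ≃ₗ[ℝ]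
      (lagrangianCurve Y t ⊓ verticalLagrangian n : Submodule ℝ (PhaseSpace n))) := by
  have hmap : lagrangianCurve Y t ⊓ verticalLagrangian n =
      (lagrangianCurve X t ⊓ verticalLagrangian n).map
        (shear S : PhaseSpace n →ₗ[ℝ] PhaseSpace n) := by
    rw [Submodule.map_inf _ (shear S).injective, map_eq_self shear_apply_of_mem,
      lagrangianCurve_eq_map_shear h]
  rw [hmap]
  exact ⟨(shear S).submoduleMap _⟩

end ConstSympl

open ConstSympl in
theorem corollary5p8 (n : ℕ) (𝔄 𝔅 ℭ : Matrix (Fin n) (Fin n) ℝ)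
    (h𝔅 : 𝔅.IsSymm) (hℭ : ℭ.IsSymm) (h𝔅unit : IsUnit 𝔅) (h𝔄 : (𝔅⁻¹ * 𝔄).IsSymm)
    (X : Matrix (Fin n ⊕ Fin n) (Fin n ⊕ Fin n) ℝ) (hX : X = Matrix.fromBlocks 𝔄 𝔅 ℭ (-𝔄.transpose))
    (A g : Matrix (Fin n) (Fin n) ℝ)
    (hA : A = 𝔅 * (𝔄.transpose * 𝔅⁻¹ * 𝔄 + ℭ)) (hg : g = 𝔅⁻¹) (T : ℝ) (hT : 0 < T) :
    (g.IsSymm ∧ IsUnit g ∧ (g * A).IsSymm) ∧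
    symplecticConjugateInstants X T = conjugateInstants A T ∧
    (∀ t ∈ Set.Ioc 0 T, symplecticMultiplicity X t = multiplicity A T t) ∧
    IsSymplecticMaslovIndex X T (symplecticMaslovIndex X T) ∧
    IsSecondOrderMaslovIndex g A T (secondOrderMaslovIndex g A T) ∧
    symplecticMaslovIndex X T = secondOrderMaslovIndex g A T := by
  have hdet := (Matrix.isUnit_iff_isUnit_det 𝔅).1 h𝔅unit
  have hgs : g.IsSymm := by
    rw [hg, Matrix.IsSymm, Matrix.transpose_nonsing_inv, h𝔅.eq]
  have hgu : IsUnit g := by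
    rw [hg]
    exact (Matrix.isUnit_nonsing_inv_iff).2 h𝔅unit
  have hgA : (g * A).IsSymm := by
    rw [hg, hA, Matrix.nonsing_inv_mul_cancel_left _ _ hdet]
    refine Matrix.IsSymm.add ?_ hℭ
    rw [Matrix.IsSymm, Matrix.transpose_mul, Matrix.transpose_mul, Matrix.transpose_nonsing_inv,
      h𝔅.eq, Matrix.transpose_transpose, Matrix.mul_assoc]
  have hshear : shearMatrix (𝔅⁻¹ * 𝔄) * X = secondOrderMatrix g A * shearMatrix (𝔅⁻¹ * 𝔄) := by
    rw [hX, hg, hA, shearMatrix_mul_fromBlocks h𝔅 h𝔅unit h𝔄]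
  have hXham : IsHamiltonian X := by
    rw [hX]
    exact isHamiltonian_fromBlocks h𝔅 hℭ
  have hequiv : ∀ t ∈ Set.Ioc 0 T, Nonempty
      ((lagrangianCurve X t ⊓ verticalLagrangian n : Submodule ℝ (PhaseSpace n)) ≃ₗ[ℝ]
        conjugateSolutions A (Set.Icc 0 T) 0 t) := fun t ht =>
    (nonempty_lagrangianCurve_inf_equiv hshear t).map2 (fun e e' => e ≪≫ₗ e'.symm)
      (nonempty_conjugateSolutions_equiv hgu A ht)
  -- The two predicates agree for every `m`, so the indices chosen from them by `Classical.epsilon`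
  -- are equal without uniqueness of `m`.
  have hiff (m : ℤ) : IsSecondOrderMaslovIndex g A T m ↔ IsSymplecticMaslovIndex X T m := by
    have hcurve := funext (lagrangianCurve_eq_map_shear hshear)
    rw [IsSecondOrderMaslovIndex, IsSymplecticMaslovIndex, hcurve]
    exact isMaslovIndex_map_iff isLagrangian_verticalLagrangian
      hXham.isLagrangian_lagrangianCurve (symplecticForm_shear h𝔄) shear_apply_of_mem
  have hindex : IsSymplecticMaslovIndex X T (symplecticMaslovIndex X T) :=
    Classical.epsilon_spec (hXham.exists_isMaslovIndex hT.le)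
  have heq : symplecticMaslovIndex X T = secondOrderMaslovIndex g A T :=
    congrArg Classical.epsilon (funext fun m => propext (hiff m).symm)
  refine ⟨⟨hgs, hgu, hgA⟩, ?_, fun t ht => ?_, hindex, ?_, heq⟩
  · ext t
    refine and_congr_right fun ht => ?_
    obtain ⟨e⟩ := hequiv t ht
    rw [← Submodule.ne_bot_iff]
    -- The Lagrangian condition in the Maslov cycle holds automatically along the curve; only the
    -- nontrivial intersection matters.
    refine (and_iff_right (hXham.isLagrangian_lagrangianCurve t)).trans (not_congr ?_)
    rw [← Submodule.subsingleton_iff_eq_bot, ← Submodule.subsingleton_iff_eq_bot]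
    exact e.toEquiv.subsingleton_congr
  · obtain ⟨e⟩ := hequiv t ht
    exact e.finrank_eq
  · rw [← heq]
    exact (hiff _).2 hindex
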